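/- Let $G$ be a group and let $Q$ be a quasi-normal subgroup of $G$, i.e. for every $g\in G$ the subgroup $gQg^{-1}\cap Q$ has finite index in both $Q$ and $gQg^{-1}$. For a finite generating set $S$ of $G$ let $\Lambda(S,Q,G)$ be the graph whose vertices are the left cosets $gQ$, with an edge labeled $s$ from $gQ$ to $fQ$ whenever $s\in S$ and $gq_1sq_2=f$ for some $q_1,q_2\in Q$ (edge paths may traverse edges in either direction). An end of a graph is an equivalence class of proper infinite edge paths, that is, infinite edge paths that visit each vertex only finitely often; two such paths $r,r'$ are equivalent if for every finite subgraph $C$ there is an edge path in the complement of $C$ from a vertex of $r$ to a vertex of $r'$. Then for every finite generating set $S$ of $G$ the set of ends of $\Lambda(S,Q,G)$ has $0$, $1$ or $2$ elements or is uncountable. Moreover, for any two finite generating sets $S$ and $T$ of $G$, the sets of ends of $\Lambda(S,Q,G)$ and $\Lambda(T,Q,G)$ have the same cardinality. -/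

import Mathlib

/-- A subgroup `Q` of `G` is quasi-normal if its commensurator is the whole group: for every
`g : G` the intersection of `g Q g⁻¹` and `Q` has finite index in both. -/
def Subgroup.IsQuasiNormal {G : Type*} [Group G] (Q : Subgroup G) : Prop :=
  Subgroup.Commensurable.commensurator Q = ⊤

/-- `IsCosetEdge S H v s w`: there is a directed edge labelled `s` from the left coset `v` to the
left coset `w`, that is, `s ∈ S` and, writing `v = gH` and `w = fH`, we have `g h₁ s h₂ = f` for
some `h₁, h₂ ∈ H`. -/
def IsCosetEdge {G : Type*} [Group G] (S : Set G) (H : Subgroup G) (v : G ⧸ H) (s : G)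
    (w : G ⧸ H) : Prop :=
  s ∈ S ∧ ∃ g f : G, (g : G ⧸ H) = v ∧ (f : G ⧸ H) = w ∧
    ∃ h₁ ∈ H, ∃ h₂ ∈ H, g * h₁ * s * h₂ = f

/-- The left coset graph `Λ(S, H, G)`. Its vertices are the left cosets of `H`; its edges are the
triples `(v, s, w)` with `IsCosetEdge S H v s w`, such an edge joining `v` and `w`. Loops and
multiple edges (with different labels or directions) are allowed; edge paths may traverse an edge
in either direction. -/
def cosetGraph {G : Type*} [Group G] (S : Set G) (H : Subgroup G) :
    Graph (G ⧸ H) ((G ⧸ H) × G × (G ⧸ H)) where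
  vertexSet := Set.univ
  IsLink e x y := IsCosetEdge S H e.1 e.2.1 e.2.2 ∧
    ((x = e.1 ∧ y = e.2.2) ∨ (x = e.2.2 ∧ y = e.1))
  isLink_symm _ _ := ⟨fun _ _ h => ⟨h.1, h.2.symm.imp And.symm And.symm⟩⟩
  eq_or_eq_of_isLink_of_isLink := by
    rintro e x y v w ⟨-, ⟨rfl, rfl⟩ | ⟨rfl, rfl⟩⟩ ⟨-, ⟨rfl, rfl⟩ | ⟨rfl, rfl⟩⟩ <;> simp
  left_mem_of_isLink _ _ _ _ := Set.mem_univ _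

namespace Graph

variable {α β : Type*}

/-- A proper edge path `[0, ∞) → X` in a graph: an infinite sequence of consecutive edges which
visits every vertex only finitely often. (Every compact subset of a graph lies in a finite
subgraph, and an edge path traverses an edge only when it visits its end points, so this is
properness of the path as a continuous map.) -/
structure ProperRay (X : Graph α β) where
  vert : ℕ → α
  edge : ℕ → β
  isLink : ∀ n, X.IsLink (edge n) (vert n) (vert (n + 1))
  proper : ∀ v, {n | vert n = v}.Finite

/-- There is a (finite, possibly trivial) edge path from `x` to `y` none of whose vertices lies
in `C`; equivalently an edge path in the complement of any subgraph with vertex set `C`. -/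
def JoinedOutside (X : Graph α β) (C : Set α) (x y : α) : Prop :=
  x ∉ C ∧ Relation.ReflTransGen (fun a b => b ∉ C ∧ X.Adj a b) x y

/-- Two proper edge paths converge to the same end if outside any finite subgraph some vertex of
the first can be joined to some vertex of the second. -/
def ProperRay.SameEnd {X : Graph α β} (r s : X.ProperRay) : Prop :=
  ∀ C : Set α, C.Finite → ∃ i j, X.JoinedOutside C (r.vert i) (s.vert j)

theorem JoinedOutside.right_notMem {X : Graph α β} {C : Set α} {x y : α}
    (h : X.JoinedOutside C x y) : y ∉ C := by
  obtain ⟨hx, h⟩ := h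
  cases h with
  | refl => exact hx
  | tail _ h => exact h.1

theorem JoinedOutside.trans {X : Graph α β} {C : Set α} {x y z : α}
    (h : X.JoinedOutside C x y) (h' : X.JoinedOutside C y z) : X.JoinedOutside C x z :=
  ⟨h.1, h.2.trans h'.2⟩

theorem JoinedOutside.symm {X : Graph α β} {C : Set α} {x y : α}
    (h : X.JoinedOutside C x y) : X.JoinedOutside C y x := by
  obtain ⟨hx, h⟩ := h
  induction h with
  | refl => exact ⟨hx, .refl⟩
  | @tail b c hb hbc ih => exact ⟨hbc.1, .head ⟨ih.1, hbc.2.symm⟩ ih.2⟩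

theorem JoinedOutside.mono {X : Graph α β} {C D : Set α} {x y : α} (hCD : C ⊆ D)
    (h : X.JoinedOutside D x y) : X.JoinedOutside C x y :=
  ⟨fun hx => h.1 (hCD hx), 
    Relation.ReflTransGen.mono (fun _ _ hab => ⟨fun hb => hab.1 (hCD hb), hab.2⟩) _ _ h.2⟩

theorem ProperRay.exists_forall_notMem {X : Graph α β} (r : X.ProperRay) {C : Set α}
    (hC : C.Finite) : ∃ N, ∀ n, N ≤ n → r.vert n ∉ C := by
  have hfin : {n | r.vert n ∈ C}.Finite := by
    refine (hC.biUnion fun v _ => r.proper v).subset fun n hn => ?_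
    simpa using hn
  obtain ⟨N, hN⟩ := hfin.bddAbove
  exact ⟨N + 1, fun n hn h => absurd (hN h) (by omega)⟩

theorem ProperRay.joinedOutside {X : Graph α β} (r : X.ProperRay) {C : Set α} {N : ℕ}
    (hN : ∀ n, N ≤ n → r.vert n ∉ C) {i j : ℕ} (hi : N ≤ i) (hij : i ≤ j) :
    X.JoinedOutside C (r.vert i) (r.vert j) := by
  induction j, hij using Nat.le_induction with
  | base => exact ⟨hN i hi, .refl⟩
  | succ j hij ih => exact ⟨ih.1, ih.2.tail ⟨hN _ (by omega), _, r.isLink j⟩⟩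

theorem ProperRay.SameEnd.trans {X : Graph α β} {r s t : X.ProperRay}
    (hrs : r.SameEnd s) (hst : s.SameEnd t) : r.SameEnd t := by
  intro C hC
  obtain ⟨N, hN⟩ := s.exists_forall_notMem hC
  have hD : (C ∪ s.vert '' Set.Iio N).Finite := hC.union ((Set.finite_Iio N).image _)
  have key : ∀ n, s.vert n ∉ C ∪ s.vert '' Set.Iio N → N ≤ n := fun n hn => by
    by_contra hlt
    exact hn (Or.inr ⟨n, by simpa using hlt, rfl⟩)
  obtain ⟨i, j, hij⟩ := hrs _ hD
  obtain ⟨k, l, hkl⟩ := hst _ hD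
  have hj := key j hij.right_notMem
  have hk := key k hkl.1
  have hjk : X.JoinedOutside C (s.vert j) (s.vert k) := by
    rcases le_total j k with h | h
    · exact s.joinedOutside hN hj h
    · exact (s.joinedOutside hN hk h).symm
  exact ⟨i, l, ((hij.mono Set.subset_union_left).trans hjk).trans
    (hkl.mono Set.subset_union_left)⟩

/-- Convergence to the same end, as an equivalence relation on the proper edge paths. -/
def properRaySetoid (X : Graph α β) : Setoid X.ProperRay where
  r := ProperRay.SameEnd
  iseqv :=
    { refl := fun r C hC => by
        obtain ⟨N, hN⟩ := r.exists_forall_notMem hC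
        exact ⟨N, N, hN N le_rfl, .refl⟩
      symm := fun h C hC => by
        obtain ⟨i, j, hij⟩ := h C hC
        exact ⟨j, i, hij.symm⟩
      trans := ProperRay.SameEnd.trans }

/-- The set of ends of a graph: proper edge paths up to convergence to the same end. -/
def Ends (X : Graph α β) : Type _ := Quotient X.properRaySetoid

/-- The number of ends of a graph, as a cardinal. -/
noncomputable def numEnds (X : Graph α β) : Cardinal := Cardinal.mk X.Ends

end Graph

/-!
Quasi-normality of `Q` says that the `Q`-orbits on `G ⧸ Q` are finite, so the coset graph of a
finite generating set is locally finite and connected, and `G` acts on it by automorphisms which are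
transitive on the vertices.

If the same group acts in this way on two graphs with the same vertices, then edges of either graph
join vertices at bounded distance in the other one. Hence being joined outside finite sets means the
same for both graphs, and a proper ray of one graph can be replaced by a proper ray of the other one
converging to the same end.

If there are three ends, some ball `K` leaves three infinite components. Let `U` be an infinite
component of the complement of a finite set `C`, let `E` be a large ball containing `C` and `e` an
end, and move `K` far out into `U` by a translation `g`. At most one of the three components of the
complement of `g • K` meets `E` and at most one contains `e`, so some component misses both, and it
lies in `U` because it misses `C` and is adjacent to `g • K`.
Iterating this along a sequence of ends produces, by Cantor's diagonal argument, an end which is not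
in the sequence, so the number of ends is uncountable.
-/

namespace GraphEnds

open Filter Relation Set
open scoped Pointwise

/-! ### Sequences -/

section Sequences

variable {α : Type*}

theorem exists_seq_of_forall_exists {P : ℕ → α → Prop} {r : α → α → Prop} (h0 : ∃ a, P 0 a)
    (h : ∀ n a, P n a → ∃ b, P (n + 1) b ∧ r a b) :
    ∃ f : ℕ → α, (∀ n, P n (f n)) ∧ ∀ n, r (f n) (f (n + 1)) := by
  obtain ⟨a, ha⟩ := h0
  have : Nonempty α := ⟨a⟩
  choose! next hP hr using h
  let f : ℕ → α := fun n => n.rec a next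
  have hf : ∀ n, P n (f n) := fun n => by
    induction n with
    | zero => exact ha
    | succ n ih => exact hP n _ ih
  exact ⟨f, hf, fun n => hr n _ (hf n)⟩

theorem exists_seq_of_transGen {r : α → α → Prop} {a b : α} (h : TransGen r a b) :
    ∃ (n : ℕ) (p : ℕ → α), 0 < n ∧ p 0 = a ∧ p n = b ∧ ∀ i < n, r (p i) (p (i + 1)) := by
  induction h using TransGen.head_induction_on with
  | @single a hab =>
    exact ⟨1, fun i => i.casesOn a fun _ => b, one_pos, rfl, rfl, by simpa using hab⟩
  | @head a c hac _ ih =>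
    obtain ⟨n, p, -, hp0, hpn, hp⟩ := ih
    refine ⟨n + 1, fun i => i.casesOn a p, n.succ_pos, rfl, hpn, fun i hi => ?_⟩
    cases i with
    | zero =>
      change r a (p 0)
      rwa [hp0]
    | succ i => exact hp i (Nat.lt_of_succ_lt_succ hi)

theorem exists_mem_Ico_of_strictMono {g : ℕ → ℕ} (hg : StrictMono g) {n k : ℕ} (hk : g n ≤ k) :
    ∃ m ≥ n, k ∈ Ico (g m) (g (m + 1)) := by
  let m := Nat.findGreatest (g · ≤ k) k
  have hle : ∀ i, g i ≤ k → i ≤ m := fun i hi => Nat.le_findGreatest ((hg.id_le i).trans hi) hi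
  have hm : g m ≤ k := Nat.findGreatest_spec (P := (g · ≤ k)) ((hg.id_le n).trans hk) hk
  exact ⟨m, hle n hk, hm, not_le.1 fun h => (hle _ h).not_gt m.lt_succ_self⟩

theorem exists_seq_of_forall_transGen {r : ℕ → α → α → Prop} {w : ℕ → α}
    (h : ∀ n, TransGen (r n) (w n) (w (n + 1))) :
    ∃ (f : ℕ → α) (g : ℕ → ℕ), StrictMono g ∧ g 0 = 0 ∧ (∀ n, f (g n) = w n) ∧
      ∀ n, ∀ k ≥ g n, ∃ m ≥ n, r m (f k) (f (k + 1)) := by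
  choose len p hlen hp0 hplen hp using fun n => exists_seq_of_transGen (h n)
  let g : ℕ → ℕ := fun n => ∑ i ∈ Finset.range n, len i
  have hg : ∀ n, g (n + 1) = g n + len n := fun n => Finset.sum_range_succ _ _
  have hmono : StrictMono g := strictMono_nat_of_lt_succ fun n => by have := hlen n; rw [hg]; omega
  choose seg _ hseg using fun k => exists_mem_Ico_of_strictMono hmono (n := 0) (Nat.zero_le k)
  have hseg_eq : ∀ n, ∀ k ∈ Ico (g n) (g (n + 1)), seg k = n := fun n k hk => by
    by_contra hne
    exact disjoint_left.1 (hmono.monotone.pairwise_disjoint_on_Ico_succ hne) (hseg k) hk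
  let f : ℕ → α := fun k => p (seg k) (k - g (seg k))
  have hf_lt : ∀ n, ∀ i < len n, f (g n + i) = p n i := fun n i hi => by
    have hmem : g n + i ∈ Ico (g n) (g (n + 1)) := ⟨Nat.le_add_right _ _, by rw [hg]; omega⟩
    simp only [f, hseg_eq n _ hmem, Nat.add_sub_cancel_left]
  have hf_start : ∀ n, f (g n) = w n := fun n => (hf_lt n 0 (hlen n)).trans (hp0 n)
  have hf_le : ∀ n, ∀ i ≤ len n, f (g n + i) = p n i := fun n i hi => by
    rcases hi.lt_or_eq with hi | rfl
    · exact hf_lt n i hi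
    · rw [← hg, hf_start, hplen]
  refine ⟨f, g, hmono, rfl, hf_start, fun n k hk => ?_⟩
  obtain ⟨m, hnm, hgm, hk'⟩ := exists_mem_Ico_of_strictMono hmono hk
  obtain ⟨i, rfl⟩ := Nat.exists_eq_add_of_le hgm
  have hi : i < len m := by rw [hg] at hk'; omega
  refine ⟨m, hnm, ?_⟩
  rw [add_assoc, hf_le m i hi.le, hf_le m (i + 1) hi]
  exact hp m i hi

end Sequences

variable {α β : Type*} {X Y : Graph α β} {A C D K U V : Set α} {u v w : ℕ → α}

/-! ### Balls -/

/-- Every vertex has finitely many neighbours. (Parallel edges are not counted: ends only see the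
adjacency relation.) -/
def IsLocallyFinite (X : Graph α β) : Prop :=
  ∀ a, {b | X.Adj a b}.Finite

/-- Any two elements of `α` are joined by an edge path of `X`; in particular, every element of `α`
is a vertex as soon as there are two of them. -/
def IsConnected (X : Graph α β) : Prop :=
  ∀ a b, ReflTransGen X.Adj a b

/-- The ball of radius `n` around the vertex `a` for the path metric. -/
def ball (X : Graph α β) (a : α) : ℕ → Set α
  | 0 => {a}
  | n + 1 => ball X a n ∪ {c | ∃ b ∈ ball X a n, X.Adj b c}

theorem monotone_ball (X : Graph α β) (a : α) : Monotone (ball X a) :=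
  monotone_nat_of_le_succ fun _ => subset_union_left

theorem self_mem_ball (X : Graph α β) (a : α) (n : ℕ) : a ∈ ball X a n :=
  monotone_ball X a n.zero_le rfl

theorem mem_ball_succ_of_adj {a b c : α} {n : ℕ} (hab : X.Adj a b) (hc : c ∈ ball X b n) :
    c ∈ ball X a (n + 1) := by
  induction n generalizing c with
  | zero =>
    obtain rfl : c = b := hc
    exact .inr ⟨a, rfl, hab⟩
  | succ n ih =>
    rcases hc with hc | ⟨d, hd, hdc⟩
    · exact .inl (ih hc)
    · exact .inr ⟨d, ih hd, hdc⟩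

theorem mem_ball_symm {a b : α} {n : ℕ} (h : b ∈ ball X a n) : a ∈ ball X b n := by
  induction n generalizing b with
  | zero => exact Eq.symm h
  | succ n ih =>
    rcases h with h | ⟨c, hc, hcb⟩
    · exact .inl (ih h)
    · exact mem_ball_succ_of_adj hcb.symm (ih hc)

theorem IsLocallyFinite.finite_ball (hX : IsLocallyFinite X) (a : α) (n : ℕ) :
    (ball X a n).Finite := by
  induction n with
  | zero => exact finite_singleton a
  | succ n ih => exact ih.union ((ih.biUnion fun b _ => hX b).subset fun c => by simp)

theorem IsConnected.exists_mem_ball (hX : IsConnected X) (a b : α) : ∃ n, b ∈ ball X a n := by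
  induction hX a b with
  | refl => exact ⟨0, rfl⟩
  | tail _ hbc ih =>
    obtain ⟨n, hn⟩ := ih
    exact ⟨n + 1, .inr ⟨_, hn, hbc⟩⟩

theorem IsConnected.exists_subset_ball (hX : IsConnected X) (a : α) (hC : C.Finite) :
    ∃ n, C ⊆ ball X a n := by
  choose d hd using hX.exists_mem_ball a
  obtain ⟨n, hn⟩ := (hC.image d).bddAbove
  exact ⟨n, fun c hc => monotone_ball X a (hn ⟨c, hc, rfl⟩) (hd c)⟩

/-! ### Connected sets and infinite components -/

/-- A set of vertices which spans a connected subgraph. -/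
def IsConnectedSet (X : Graph α β) (A : Set α) : Prop :=
  ∀ x ∈ A, ∀ y ∈ A, X.JoinedOutside Aᶜ x y

theorem IsConnectedSet.joinedOutside (hA : IsConnectedSet X A) (hAC : Disjoint A C) {x y : α}
    (hx : x ∈ A) (hy : y ∈ A) : X.JoinedOutside C x y :=
  (hA x hx y hy).mono (subset_compl_iff_disjoint_left.2 hAC)

theorem isConnectedSet_ball (X : Graph α β) (a : α) (n : ℕ) : IsConnectedSet X (ball X a n) := by
  suffices ∀ b ∈ ball X a n, X.JoinedOutside (ball X a n)ᶜ a b from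
    fun x hx y hy => (this x hx).symm.trans (this y hy)
  induction n with
  | zero =>
    rintro b rfl
    exact ⟨not_not.2 rfl, .refl⟩
  | succ n ih =>
    have hsub := compl_subset_compl.2 (monotone_ball X a n.le_succ)
    rintro c (hc | ⟨b, hb, hbc⟩)
    · exact (ih c hc).mono hsub
    · exact ⟨not_not.2 (self_mem_ball X a _),
        ((ih b hb).mono hsub).2.tail ⟨not_not.2 (.inr ⟨b, hb, hbc⟩), hbc⟩⟩

/-- `U` is an infinite connected component of the complement of `C`. -/
structure IsInfiniteComponent (X : Graph α β) (C U : Set α) : Prop where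
  infinite : U.Infinite
  mem_iff : ∀ x ∈ U, ∀ y, y ∈ U ↔ X.JoinedOutside C x y

namespace IsInfiniteComponent

theorem disjoint (hU : IsInfiniteComponent X C U) : Disjoint U C :=
  disjoint_left.2 fun x hx => ((hU.mem_iff x hx x).1 hx).1

theorem isConnectedSet (hU : IsInfiniteComponent X C U) : IsConnectedSet X U := by
  intro x hx y hy
  refine ⟨not_not.2 hx, ?_⟩
  induction ((hU.mem_iff x hx y).1 hy).2 with
  | refl => exact .refl
  | tail hxb hbc ih =>
    have hx' := ((hU.mem_iff x hx x).1 hx).1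
    have hb := (hU.mem_iff x hx _).2 ⟨hx', hxb⟩
    have hc := (hU.mem_iff x hx _).2 ⟨hx', hxb.tail hbc⟩
    exact (ih hb).tail ⟨not_not.2 hc, hbc.2⟩

theorem subset_of_isConnectedSet (hU : IsInfiniteComponent X C U) (hA : IsConnectedSet X A)
    (hAC : Disjoint A C) (h : (A ∩ U).Nonempty) : A ⊆ U := by
  obtain ⟨x, hxA, hxU⟩ := h
  exact fun y hy => (hU.mem_iff x hxU y).2 (hA.joinedOutside hAC hxA hy)

theorem eq_of_inter_nonempty (hU : IsInfiniteComponent X C U) (hV : IsInfiniteComponent X C V)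
    (h : (U ∩ V).Nonempty) : U = V :=
  (hV.subset_of_isConnectedSet hU.isConnectedSet hU.disjoint h).antisymm
    (hU.subset_of_isConnectedSet hV.isConnectedSet hV.disjoint (inter_comm U V ▸ h))

theorem exists_adj (hV : IsInfiniteComponent X K V) (hX : IsConnected X) (hK : K.Nonempty) :
    ∃ a ∈ V, ∃ b ∈ K, X.Adj a b := by
  obtain ⟨x, hx⟩ := hV.infinite.nonempty
  obtain ⟨o, ho⟩ := hK
  by_contra! h
  have stays : ∀ y, ReflTransGen X.Adj x y → y ∈ V := by
    intro y hxy
    induction hxy with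
    | refl => exact hx
    | @tail b c _ hbc hb =>
      exact (hV.mem_iff b hb c).2
        ⟨disjoint_left.1 hV.disjoint hb, .single ⟨fun hc => h b hb c hc hbc, hbc⟩⟩
  exact disjoint_left.1 hV.disjoint (stays o (hX x o)) ho

theorem subset_of_subset (hU : IsInfiniteComponent X C U) (hV : IsInfiniteComponent X K V)
    (hX : IsConnected X) (hK : K.Nonempty) (hKU : K ⊆ U) (hVC : Disjoint V C) : V ⊆ U := by
  obtain ⟨a, ha, b, hb, hab⟩ := hV.exists_adj hX hK
  have haU : a ∈ U := (hU.mem_iff b (hKU hb) a).2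
    ⟨disjoint_left.1 hU.disjoint (hKU hb), .single ⟨disjoint_left.1 hVC ha, hab.symm⟩⟩
  exact hU.subset_of_isConnectedSet hV.isConnectedSet hVC ⟨a, ha, haU⟩

end IsInfiniteComponent

/-- An infinite component of the complement of some finite set of vertices: a basic open set of the
space of ends. -/
def IsEndNeighborhood (X : Graph α β) (U : Set α) : Prop :=
  ∃ C : Set α, C.Finite ∧ IsInfiniteComponent X C U

/-! ### Sequences converging to an end -/

/-- A sequence of vertices converges to an end if outside any finite set its consecutive terms are
eventually joined. -/
def TendsToEnd (X : Graph α β) (v : ℕ → α) : Prop :=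
  ∀ C : Set α, C.Finite → ∀ᶠ n in atTop, X.JoinedOutside C (v n) (v (n + 1))

/-- Two sequences of vertices are asymptotic if outside any finite set their terms with the same
index are eventually joined. For sequences converging to ends this says that the ends agree. -/
def Asymptotic (X : Graph α β) (u v : ℕ → α) : Prop :=
  ∀ C : Set α, C.Finite → ∀ᶠ n in atTop, X.JoinedOutside C (u n) (v n)

theorem Asymptotic.symm (h : Asymptotic X u v) : Asymptotic X v u := fun C hC =>
  (h C hC).mono fun _ => .symm

theorem Asymptotic.trans (huv : Asymptotic X u v) (hvw : Asymptotic X v w) : Asymptotic X u w :=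
  fun C hC => ((huv C hC).and (hvw C hC)).mono fun _ h => h.1.trans h.2

theorem TendsToEnd.exists_forall_joinedOutside (hv : TendsToEnd X v) (hC : C.Finite) :
    ∃ N, ∀ m ≥ N, ∀ n ≥ N, X.JoinedOutside C (v m) (v n) := by
  obtain ⟨N, hN⟩ := eventually_atTop.1 (hv C hC)
  have hle : ∀ n ≥ N, X.JoinedOutside C (v N) (v n) := fun n hn => by
    induction n, hn using Nat.le_induction with
    | base => exact ⟨(hN N le_rfl).1, .refl⟩
    | succ n hn ih => exact ih.trans (hN n hn)
  exact ⟨N, fun m hm n hn => (hle m hm).symm.trans (hle n hn)⟩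

theorem TendsToEnd.asymptotic (hu : TendsToEnd X u) (hv : TendsToEnd X v)
    (h : ∀ C : Set α, C.Finite → ∀ N, ∃ i ≥ N, ∃ j ≥ N, X.JoinedOutside C (u i) (v j)) :
    Asymptotic X u v := by
  intro C hC
  obtain ⟨M, hM⟩ := hu.exists_forall_joinedOutside hC
  obtain ⟨N, hN⟩ := hv.exists_forall_joinedOutside hC
  obtain ⟨i, hi, j, hj, hij⟩ := h C hC (max M N)
  filter_upwards [eventually_ge_atTop (max M N)] with n hn
  exact ((hM n (le_of_max_le_left hn) i (le_of_max_le_left hi)).trans hij).trans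
    (hN j (le_of_max_le_right hj) n (le_of_max_le_right hn))

theorem tendsToEnd_of_antitone {U : ℕ → Set α} (hU : Antitone U)
    (hconn : ∀ n, IsConnectedSet X (U n))
    (hdisj : ∀ C : Set α, C.Finite → ∃ n, Disjoint (U n) C) (hv : ∀ n, v n ∈ U n) :
    TendsToEnd X v := by
  intro C hC
  obtain ⟨N, hN⟩ := hdisj C hC
  filter_upwards [eventually_ge_atTop N] with n hn
  exact (hconn N).joinedOutside hN (hU hn (hv n)) (hU (Nat.le_succ_of_le hn) (hv (n + 1)))

theorem tendsToEnd_vert (r : X.ProperRay) : TendsToEnd X r.vert := fun _ hC => by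
  obtain ⟨N, hN⟩ := r.exists_forall_notMem hC
  filter_upwards [eventually_ge_atTop N] with n hn
  exact r.joinedOutside hN hn n.le_succ

theorem sameEnd_iff_asymptotic {r s : X.ProperRay} :
    r.SameEnd s ↔ Asymptotic X r.vert s.vert := by
  refine ⟨fun h => (tendsToEnd_vert r).asymptotic (tendsToEnd_vert s) fun C hC N => ?_,
    fun h C hC => ?_⟩
  · have hfin (t : X.ProperRay) : (t.vert '' Iio N).Finite := (finite_Iio N).image _
    obtain ⟨i, j, hij⟩ := h _ (hC.union ((hfin r).union (hfin s)))
    have hi : N ≤ i := not_lt.1 fun hi => hij.1 (.inr (.inl ⟨i, hi, rfl⟩))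
    have hj : N ≤ j := not_lt.1 fun hj => hij.right_notMem (.inr (.inr ⟨j, hj, rfl⟩))
    exact ⟨i, hi, j, hj, hij.mono subset_union_left⟩
  · obtain ⟨n, hn⟩ := (h C hC).exists
    exact ⟨n, n, hn⟩

theorem exists_properRay_through {D : ℕ → Set α} (hD : Monotone D) (hcover : ∀ a, ∃ n, a ∈ D n)
    (hne : ∀ n, w n ≠ w (n + 1)) (hw : ∀ n, X.JoinedOutside (D n) (w n) (w (n + 1))) :
    ∃ (r : X.ProperRay) (g : ℕ → ℕ), StrictMono g ∧ ∀ n, r.vert (g n) = w n := by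
  obtain ⟨f, g, hg, hg0, hfg, hf⟩ := exists_seq_of_forall_transGen fun n =>
    (reflTransGen_iff_eq_or_transGen.1 (hw n).2).resolve_left (hne n).symm
  have hstep : ∀ n, ∀ k ≥ g n, f (k + 1) ∉ D n ∧ X.Adj (f k) (f (k + 1)) := fun n k hk => by
    obtain ⟨m, hnm, hout, hadj⟩ := hf n k hk
    exact ⟨fun h => hout (hD hnm h), hadj⟩
  choose e he using fun k => (hstep 0 k (hg0.trans_le k.zero_le)).2
  refine ⟨⟨f, e, he, fun a => ?_⟩, g, hg, hfg⟩
  obtain ⟨n, hn⟩ := hcover a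
  refine (finite_Iic (g n)).subset fun k hk => mem_Iic.2 (not_lt.1 fun hgk => ?_)
  obtain ⟨j, rfl⟩ := Nat.exists_eq_add_of_lt hgk
  exact (hstep n (g n + j) (Nat.le_add_right _ _)).1 (hk ▸ hn)

theorem TendsToEnd.exists_subseq (hv : TendsToEnd X v) {D : ℕ → Set α} (hD : ∀ n, (D n).Finite) :
    ∃ t : ℕ → ℕ, StrictMono t ∧ (∀ n, v (t n) ≠ v (t (n + 1))) ∧
      ∀ n, X.JoinedOutside (D n) (v (t n)) (v (t (n + 1))) := by
  choose N hN using fun n => hv.exists_forall_joinedOutside (hD n)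
  have hnext : ∀ n i, N n ≤ i → ∃ j, N (n + 1) ≤ j ∧ i < j ∧ v i ≠ v j := fun n i _ => by
    obtain ⟨M, hM⟩ := hv.exists_forall_joinedOutside (finite_singleton (v i))
    let j := max M (max (N (n + 1)) (i + 1))
    have hj : v j ∉ {v i} := (hM j (le_max_left _ _) j (le_max_left _ _)).1
    exact ⟨j, by omega, by omega, fun h => hj h.symm⟩
  obtain ⟨t, ht, hnext⟩ := exists_seq_of_forall_exists ⟨N 0, le_rfl⟩ hnext
  exact ⟨t, strictMono_nat_of_lt_succ fun n => (hnext n).1, fun n => (hnext n).2,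
    fun n => hN n _ (ht n) _ ((ht n).trans (hnext n).1.le)⟩

theorem TendsToEnd.exists_properRay (hlf : IsLocallyFinite X) (hconn : IsConnected X)
    (hv : TendsToEnd X v) : ∃ r : X.ProperRay, Asymptotic X v r.vert := by
  obtain ⟨t, ht, hne, hjoin⟩ := hv.exists_subseq fun n => hlf.finite_ball (v 0) n
  obtain ⟨r, g, hg, hrg⟩ := exists_properRay_through (monotone_ball X (v 0))
    (hconn.exists_mem_ball (v 0)) hne hjoin
  refine ⟨r, hv.asymptotic (tendsToEnd_vert r) fun C hC N => ?_⟩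
  obtain ⟨M, hM⟩ := hv.exists_forall_joinedOutside hC
  have hle : max M N ≤ t (max M N) := ht.id_le _
  have hjoin := hM (t (max M N)) (le_of_max_le_left hle) _ (le_of_max_le_left hle)
  exact ⟨t (max M N), le_of_max_le_right hle, g (max M N),
    (le_max_right M N).trans (hg.id_le _), hrg (max M N) ▸ hjoin⟩

/-! ### Graphs at bounded distance -/

/-- Edges of `X` join vertices which are at bounded distance in `Y`. -/
def IsCoarseSubgraph (X Y : Graph α β) : Prop :=
  ∃ n, ∀ a b, X.Adj a b → b ∈ ball Y a n

theorem joinedOutside_of_biUnion_ball {n : ℕ} (hXY : ∀ a b, X.Adj a b → b ∈ ball Y a n) {x y : α}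
    (h : X.JoinedOutside (⋃ c ∈ C, ball Y c n) x y) : Y.JoinedOutside C x y := by
  have hball : ∀ a ∉ ⋃ c ∈ C, ball Y c n, Disjoint (ball Y a n) C := fun a ha =>
    disjoint_left.2 fun c hca hc => ha (mem_biUnion hc (mem_ball_symm hca))
  obtain ⟨hx, hxy⟩ := h
  induction hxy with
  | refl => exact ⟨disjoint_left.1 (hball x hx) (self_mem_ball Y x n), .refl⟩
  | @tail b c hxb hbc ih =>
    have hb := Graph.JoinedOutside.right_notMem ⟨hx, hxb⟩
    exact ih.trans ((isConnectedSet_ball Y b n).joinedOutside (hball b hb)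
      (self_mem_ball Y b n) (hXY b c hbc.2))

theorem Asymptotic.of_isCoarseSubgraph (hY : IsLocallyFinite Y) (hXY : IsCoarseSubgraph X Y)
    (h : Asymptotic X u v) : Asymptotic Y u v := fun C hC => by
  obtain ⟨n, hn⟩ := hXY
  exact (h _ (hC.biUnion fun c _ => hY.finite_ball c n)).mono fun _ =>
    joinedOutside_of_biUnion_ball hn

theorem TendsToEnd.of_isCoarseSubgraph (hY : IsLocallyFinite Y) (hXY : IsCoarseSubgraph X Y)
    (h : TendsToEnd X v) : TendsToEnd Y v :=
  Asymptotic.of_isCoarseSubgraph hY hXY h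

theorem numEnds_le_of_isCoarseSubgraph (hXlf : IsLocallyFinite X) (hYlf : IsLocallyFinite Y)
    (hYconn : IsConnected Y) (hXY : IsCoarseSubgraph X Y) (hYX : IsCoarseSubgraph Y X) :
    X.numEnds ≤ Y.numEnds := by
  choose s hs using fun r : X.ProperRay =>
    ((tendsToEnd_vert r).of_isCoarseSubgraph hYlf hXY).exists_properRay hYlf hYconn
  have s_reflects : ∀ r r', (s r).SameEnd (s r') → r.SameEnd r' := fun r r' h => by
    have hY : Asymptotic Y r.vert r'.vert :=
      ((hs r).trans (sameEnd_iff_asymptotic.1 h)).trans (hs r').symm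
    exact sameEnd_iff_asymptotic.2 (hY.of_isCoarseSubgraph hXlf hYX)
  refine Cardinal.mk_le_of_injective (f := fun ε : X.Ends => (⟦s ε.out⟧ : Y.Ends)) fun ε ε' h => ?_
  exact Quotient.out_equiv_out.1 (s_reflects _ _ (Quotient.exact h))

/-! ### Vertex-transitive group actions -/

section Action

/-- The group `G` acts on the vertices of `X` by automorphisms of the adjacency relation. -/
def IsInvariant (G : Type*) [Group G] [MulAction G α] (X : Graph α β) : Prop :=
  ∀ (g : G) (a b : α), X.Adj a b → X.Adj (g • a) (g • b)

variable {G : Type*} [Group G] [MulAction G α]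

namespace IsInvariant

theorem joinedOutside_smul (hX : IsInvariant G X) (g : G) {x y : α} (h : X.JoinedOutside C x y) :
    X.JoinedOutside (g • C) (g • x) (g • y) :=
  ⟨fun hx => h.1 (smul_mem_smul_set_iff.1 hx), h.2.lift (g • ·) fun a b hab =>
    ⟨fun hb => hab.1 (smul_mem_smul_set_iff.1 hb), hX g a b hab.2⟩⟩

theorem smul_mem_ball (hX : IsInvariant G X) (g : G) {a b : α} {n : ℕ} (h : b ∈ ball X a n) :
    g • b ∈ ball X (g • a) n := by
  induction n generalizing b with
  | zero => exact congrArg (g • ·) h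
  | succ n ih =>
    rcases h with h | ⟨c, hc, hcb⟩
    · exact .inl (ih h)
    · exact .inr ⟨g • c, ih hc, hX g c b hcb⟩

theorem isConnectedSet_smul (hX : IsInvariant G X) (g : G) (hA : IsConnectedSet X A) :
    IsConnectedSet X (g • A) := by
  rintro _ ⟨x, hx, rfl⟩ _ ⟨y, hy, rfl⟩
  exact smul_set_compl (a := g) (s := A) ▸ hX.joinedOutside_smul g (hA x hx y hy)

theorem isInfiniteComponent_smul (hX : IsInvariant G X) (g : G) (hU : IsInfiniteComponent X C U) :
    IsInfiniteComponent X (g • C) (g • U) where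
  infinite := hU.infinite.smul_set
  mem_iff := by
    rintro _ ⟨x, hx, rfl⟩ y
    obtain ⟨y, rfl⟩ := MulAction.surjective g y
    change g • y ∈ g • U ↔ X.JoinedOutside (g • C) (g • x) (g • y)
    rw [smul_mem_smul_set_iff, hU.mem_iff x hx]
    refine ⟨hX.joinedOutside_smul g, fun h => ?_⟩
    simpa using hX.joinedOutside_smul g⁻¹ h

theorem isCoarseSubgraph [MulAction.IsPretransitive G α] (hX : IsInvariant G X)
    (hY : IsInvariant G Y) (hXlf : IsLocallyFinite X) (hYconn : IsConnected Y) :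
    IsCoarseSubgraph X Y := by
  rcases isEmpty_or_nonempty α with _ | ⟨⟨o⟩⟩
  · exact ⟨0, fun a => isEmptyElim a⟩
  obtain ⟨n, hn⟩ := hYconn.exists_subset_ball o (hXlf o)
  refine ⟨n, fun a b hab => ?_⟩
  obtain ⟨g, rfl⟩ := MulAction.exists_smul_eq G o a
  have hb : g⁻¹ • b ∈ ball Y o n := hn (by simpa using hX g⁻¹ _ _ hab)
  simpa using hY.smul_mem_ball g hb

end IsInvariant

theorem numEnds_eq_of_isInvariant [MulAction.IsPretransitive G α] (hX : IsInvariant G X)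
    (hXlf : IsLocallyFinite X) (hXconn : IsConnected X) (hY : IsInvariant G Y)
    (hYlf : IsLocallyFinite Y) (hYconn : IsConnected Y) : X.numEnds = Y.numEnds := by
  have hXY := hX.isCoarseSubgraph hY hXlf hYconn
  have hYX := hY.isCoarseSubgraph hX hYlf hXconn
  exact (numEnds_le_of_isCoarseSubgraph hXlf hYlf hYconn hXY hYX).antisymm
    (numEnds_le_of_isCoarseSubgraph hYlf hXlf hXconn hYX hXY)

theorem IsInvariant.exists_smul_ball_subset [MulAction.IsPretransitive G α] {E : Set α}
    (hX : IsInvariant G X) (hlf : IsLocallyFinite X) (hU : IsInfiniteComponent X C U)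
    (hE : E.Finite) (hCE : C ⊆ E) (o : α) (k : ℕ) :
    ∃ g : G, Disjoint (g • ball X o k) E ∧ g • ball X o k ⊆ U := by
  obtain ⟨w, hwU, hw⟩ :=
    hU.infinite.exists_notMem_finite (hE.biUnion fun y _ => hlf.finite_ball y k)
  obtain ⟨g, rfl⟩ := MulAction.exists_smul_eq G o w
  have hdisj : Disjoint (g • ball X o k) E := disjoint_left.2 fun _ ⟨_, hx, hgx⟩ hy =>
    hw (mem_biUnion hy (mem_ball_symm (hgx ▸ hX.smul_mem_ball g hx)))
  exact ⟨g, hdisj, hU.subset_of_isConnectedSet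
    (hX.isConnectedSet_smul g (isConnectedSet_ball X o k)) (hdisj.mono_right hCE)
    ⟨g • o, smul_mem_smul_set (self_mem_ball X o k), hwU⟩⟩

end Action

/-! ### The number of ends -/

/-- The component of the complement of a finite set `C` which contains a tail of the ray `r`. -/
def rayComponent (r : X.ProperRay) (C : Set α) : Set α :=
  {y | ∀ᶠ n in atTop, X.JoinedOutside C y (r.vert n)}

theorem eventually_vert_mem_rayComponent (r : X.ProperRay) (hC : C.Finite) :
    ∀ᶠ n in atTop, r.vert n ∈ rayComponent r C := by
  obtain ⟨N, hN⟩ := (tendsToEnd_vert r).exists_forall_joinedOutside hC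
  filter_upwards [eventually_ge_atTop N] with n hn
  filter_upwards [eventually_ge_atTop N] with m hm using hN n hn m hm

theorem isInfiniteComponent_rayComponent (r : X.ProperRay) (hC : C.Finite) :
    IsInfiniteComponent X C (rayComponent r C) where
  infinite hfin := by
    obtain ⟨N, hN⟩ := r.exists_forall_notMem hfin
    obtain ⟨n, hmem, hn⟩ :=
      ((eventually_vert_mem_rayComponent r hC).and (eventually_ge_atTop N)).exists
    exact hN n hn hmem
  mem_iff x hx y := by
    refine ⟨fun hy => ?_, fun hxy => hx.mono fun _ h => hxy.symm.trans h⟩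
    obtain ⟨n, hxn, hyn⟩ := (hx.and hy).exists
    exact hxn.trans hyn.symm

theorem exists_injective_isInfiniteComponent_ball {ι : Type*} [Finite ι] (hlf : IsLocallyFinite X)
    (hconn : IsConnected X) {r : ι → X.ProperRay}
    (hr : Pairwise fun i j => ¬ (r i).SameEnd (r j)) (o : α) :
    ∃ (k : ℕ) (V : ι → Set α), V.Injective ∧ ∀ i, IsInfiniteComponent X (ball X o k) (V i) := by
  have hsep : ∀ p : {p : ι × ι // p.1 ≠ p.2}, ∃ C : Set α, C.Finite ∧
      ∀ a b, ¬ X.JoinedOutside C ((r p.1.1).vert a) ((r p.1.2).vert b) := fun p => by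
    simpa [Graph.ProperRay.SameEnd] using hr p.2
  choose C hC hsep using hsep
  obtain ⟨k, hk⟩ := hconn.exists_subset_ball o (finite_iUnion hC)
  have hball := hlf.finite_ball o k
  refine ⟨k, fun i => rayComponent (r i) (ball X o k), fun i j hij => by_contra fun hne => ?_,
    fun i => isInfiniteComponent_rayComponent (r i) hball⟩
  obtain ⟨a, ha⟩ := (eventually_vert_mem_rayComponent (r i) hball).exists
  have haj : (r i).vert a ∈ rayComponent (r j) (ball X o k) := hij.subset ha
  obtain ⟨b, hb⟩ := haj.exists
  exact hsep ⟨(i, j), hne⟩ a b (hb.mono ((subset_iUnion C _).trans hk))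

theorem subsingleton_setOf_inter_nonempty {ι : Type*} {V : ι → Set α} (hinj : V.Injective)
    (hV : ∀ i, IsInfiniteComponent X K (V i)) (hA : IsConnectedSet X A) (hAK : Disjoint A K) :
    {i | (A ∩ V i).Nonempty}.Subsingleton := by
  rintro i ⟨x, hxA, hxi⟩ j hj
  have hxj : x ∈ V j := (hV j).subset_of_isConnectedSet hA hAK hj hxA
  exact hinj ((hV i).eq_of_inter_nonempty (hV j) ⟨x, hxi, hxj⟩)

theorem exists_notMem_notMem_of_subsingleton {s t : Set (Fin 3)} (hs : s.Subsingleton)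
    (ht : t.Subsingleton) : ∃ i, i ∉ s ∧ i ∉ t := by
  by_contra! h
  have hle : (univ : Set (Fin 3)).encard ≤ 1 + 1 :=
    calc (univ : Set (Fin 3)).encard
      _ ≤ (s ∪ t).encard := encard_le_encard fun i _ => or_iff_not_imp_left.2 (h i)
      _ ≤ s.encard + t.encard := encard_union_le s t
      _ ≤ 1 + 1 := add_le_add (encard_le_one_iff_subsingleton.2 hs)
        (encard_le_one_iff_subsingleton.2 ht)
  exact absurd hle (by norm_num [encard_univ])

section Transitive

variable {G : Type*} [Group G] [MulAction G α] [MulAction.IsPretransitive G α]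
  {r : Fin 3 → X.ProperRay}

theorem exists_isEndNeighborhood_subset (hX : IsInvariant G X) (hlf : IsLocallyFinite X)
    (hconn : IsConnected X) (hr : Pairwise fun i j => ¬ (r i).SameEnd (r j))
    (hU : IsEndNeighborhood X U) (hD : D.Finite) (e : X.ProperRay) :
    ∃ U' ⊆ U, IsEndNeighborhood X U' ∧ Disjoint U' D ∧ ∀ᶠ n in atTop, e.vert n ∉ U' := by
  obtain ⟨C, hC, hU⟩ := hU
  obtain ⟨o, -⟩ := hU.infinite.nonempty
  obtain ⟨k, V, hinj, hV⟩ := exists_injective_isInfiniteComponent_ball hlf hconn hr o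
  obtain ⟨m, hm⟩ := hconn.exists_subset_ball o (hC.union hD)
  obtain ⟨hCE, hDE⟩ := union_subset_iff.1 hm
  obtain ⟨g, hKE, hKU⟩ := hX.exists_smul_ball_subset hlf hU (hlf.finite_ball o m) hCE o k
  have hK : (g • ball X o k).Finite := (hlf.finite_ball o k).smul_set
  have hgV : ∀ i, IsInfiniteComponent X (g • ball X o k) (g • V i) := fun i =>
    hX.isInfiniteComponent_smul g (hV i)
  have hginj : (fun i => g • V i).Injective := (MulAction.injective g).comp hinj
  have he := isInfiniteComponent_rayComponent e hK
  obtain ⟨i, hiE, hie⟩ := exists_notMem_notMem_of_subsingleton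
    (subsingleton_setOf_inter_nonempty hginj hgV (isConnectedSet_ball X o m) hKE.symm)
    (subsingleton_setOf_inter_nonempty hginj hgV he.isConnectedSet he.disjoint)
  have hVE : Disjoint (g • V i) (ball X o m) := disjoint_iff_inter_eq_empty.2
    (inter_comm _ _ ▸ not_nonempty_iff_eq_empty.1 hiE)
  have hKne : (g • ball X o k).Nonempty := ⟨g • o, smul_mem_smul_set (self_mem_ball X o k)⟩
  exact ⟨g • V i, hU.subset_of_subset (hgV i) hconn hKne hKU (hVE.mono_right hCE),
    ⟨_, hK, hgV i⟩, hVE.mono_right hDE,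
    (eventually_vert_mem_rayComponent e hK).mono fun n hn hnV => hie ⟨_, hn, hnV⟩⟩

theorem exists_properRay_forall_not_sameEnd (hX : IsInvariant G X) (hlf : IsLocallyFinite X)
    (hconn : IsConnected X) (hr : Pairwise fun i j => ¬ (r i).SameEnd (r j))
    (e : ℕ → X.ProperRay) : ∃ s : X.ProperRay, ∀ n, ¬ (e n).SameEnd s := by
  let o := (r 0).vert 0
  let Avoids (n : ℕ) (U : Set α) : Prop := IsEndNeighborhood X U ∧ Disjoint U (ball X o n) ∧
    ∀ᶠ k in atTop, (e n).vert k ∉ U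
  have hnext : ∀ n U, IsEndNeighborhood X U → ∃ U', Avoids n U' ∧ U' ⊆ U := fun n U hU => by
    obtain ⟨U', hsub, hU'⟩ := exists_isEndNeighborhood_subset hX hlf hconn hr hU
      (hlf.finite_ball o n) (e n)
    exact ⟨U', hU', hsub⟩
  obtain ⟨U₀, hU₀, -⟩ :=
    hnext 0 _ ⟨∅, finite_empty, isInfiniteComponent_rayComponent (r 0) finite_empty⟩
  obtain ⟨U, hU, hsub⟩ := exists_seq_of_forall_exists (P := Avoids) (r := fun U U' => U' ⊆ U)
    ⟨U₀, hU₀⟩ fun n U hU => hnext (n + 1) U hU.1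
  have hanti : Antitone U := antitone_nat_of_succ_le hsub
  choose C hC hUC using fun n => (hU n).1
  choose v hv using fun n => (hUC n).infinite.nonempty
  have hdisj : ∀ D : Set α, D.Finite → ∃ n, Disjoint (U n) D := fun D hD =>
    (hconn.exists_subset_ball o hD).imp fun n hn => (hU n).2.1.mono_right hn
  obtain ⟨s, hs⟩ := (tendsToEnd_of_antitone hanti (fun n => (hUC n).isConnectedSet) hdisj
    hv).exists_properRay hlf hconn
  refine ⟨s, fun n hn => ?_⟩
  have hvn : Asymptotic X v (e n).vert := hs.trans (sameEnd_iff_asymptotic.1 hn).symm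
  obtain ⟨k, ⟨hjoin, hk⟩, hnk⟩ :=
    (((hvn (C n) (hC n)).and (hU n).2.2).and (eventually_ge_atTop n)).exists
  exact hk (((hUC n).mem_iff (v k) (hanti hnk (hv k)) _).2 hjoin)

theorem aleph0_lt_numEnds (hX : IsInvariant G X) (hlf : IsLocallyFinite X)
    (hconn : IsConnected X) (h3 : 3 ≤ X.numEnds) : Cardinal.aleph0 < X.numEnds := by
  obtain ⟨ι⟩ : Nonempty (Fin 3 ↪ X.Ends) :=
    Cardinal.lift_mk_le'.1 (by simpa [Graph.numEnds] using h3)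
  have hr : Pairwise fun i j => ¬ (ι i).out.SameEnd (ι j).out := fun i j hij h =>
    hij (ι.injective (Quotient.out_equiv_out.1 h))
  by_contra hle
  have : Countable X.Ends := Cardinal.mk_le_aleph0_iff.1 (not_lt.1 hle)
  have : Nonempty X.Ends := ⟨ι 0⟩
  obtain ⟨e, he⟩ := exists_surjective_nat X.Ends
  obtain ⟨s, hs⟩ := exists_properRay_forall_not_sameEnd hX hlf hconn hr fun n => (e n).out
  obtain ⟨n, hn⟩ := he ⟦s⟧
  exact hs n (Quotient.exact ((Quotient.out_eq (e n)).trans hn))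

theorem numEnds_eq_zero_or_one_or_two_or_aleph0_lt (hX : IsInvariant G X) (hlf : IsLocallyFinite X)
    (hconn : IsConnected X) :
    X.numEnds = 0 ∨ X.numEnds = 1 ∨ X.numEnds = 2 ∨ Cardinal.aleph0 < X.numEnds := by
  by_cases h3 : 3 ≤ X.numEnds
  · exact .inr (.inr (.inr (aleph0_lt_numEnds hX hlf hconn h3)))
  · obtain ⟨n, hn⟩ := Cardinal.lt_aleph0.1
      ((not_le.1 h3).trans (Cardinal.natCast_lt_aleph0 (n := 3)))
    rw [hn] at h3 ⊢
    have hlt : n < 3 := by exact_mod_cast not_le.1 h3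
    interval_cases n <;> simp

end Transitive

end GraphEnds

/-! ### Coset graphs -/

section CosetGraph

open scoped Pointwise

variable {G : Type*} [Group G] {Q : Subgroup G} {S : Set G}

theorem isCosetEdge_iff {v w : G ⧸ Q} {s : G} :
    IsCosetEdge S Q v s w ↔ s ∈ S ∧ ∃ g : G, (g : G ⧸ Q) = v ∧ g • (s : G ⧸ Q) = w := by
  constructor
  · rintro ⟨hs, g, _, rfl, rfl, q₁, hq₁, q₂, hq₂, rfl⟩
    exact ⟨hs, g * q₁, QuotientGroup.mk_mul_of_mem g hq₁, (QuotientGroup.mk_mul_of_mem _ hq₂).symm⟩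
  · rintro ⟨hs, g, rfl, rfl⟩
    exact ⟨hs, g, g * s, rfl, rfl, 1, Q.one_mem, 1, Q.one_mem, by simp⟩

theorem cosetGraph_adj_iff {v w : G ⧸ Q} :
    (cosetGraph S Q).Adj v w ↔
      ∃ s ∈ S ∪ S⁻¹, ∃ g : G, (g : G ⧸ Q) = v ∧ g • (s : G ⧸ Q) = w := by
  constructor
  · rintro ⟨e, hedge, hvw⟩
    obtain ⟨hs, g, hv, hw⟩ := isCosetEdge_iff.1 hedge
    rcases hvw with ⟨rfl, rfl⟩ | ⟨rfl, rfl⟩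
    · exact ⟨e.2.1, .inl hs, g, hv, hw⟩
    · exact ⟨e.2.1⁻¹, .inr (Set.inv_mem_inv.2 hs), g * e.2.1, hw,
        (congrArg _ (mul_inv_cancel_right g e.2.1)).trans hv⟩
  · rintro ⟨s, hs | hs, g, rfl, rfl⟩
    · exact ⟨(g, s, g • (s : G ⧸ Q)), isCosetEdge_iff.2 ⟨hs, g, rfl, rfl⟩, .inl ⟨rfl, rfl⟩⟩
    · refine ⟨(g • (s : G ⧸ Q), s⁻¹, g), isCosetEdge_iff.2 ⟨hs, g * s, rfl, ?_⟩, .inr ⟨rfl, rfl⟩⟩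
      exact congrArg _ (mul_inv_cancel_right g s)

theorem isInvariant_cosetGraph (S : Set G) (Q : Subgroup G) :
    GraphEnds.IsInvariant G (cosetGraph S Q) := fun f v w h => by
  obtain ⟨s, hs, g, rfl, rfl⟩ := cosetGraph_adj_iff.1 h
  exact cosetGraph_adj_iff.2 ⟨s, hs, f * g, rfl, mul_smul f g _⟩

theorem isConnected_cosetGraph (hS : Subgroup.closure S = ⊤) :
    GraphEnds.IsConnected (cosetGraph S Q) := by
  have hone : ∀ g : G, Relation.ReflTransGen (cosetGraph S Q).Adj ((1 : G) : G ⧸ Q) g := fun g => by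
    have hg : g ∈ Subgroup.closure S := hS ▸ Subgroup.mem_top g
    induction hg using Subgroup.closure_induction_right with
    | one => exact .refl
    | mul_right g _ s hs ih =>
      exact ih.tail (cosetGraph_adj_iff.2 ⟨s, .inl hs, g, rfl, rfl⟩)
    | mul_inv_cancel g _ s hs ih =>
      exact ih.tail (cosetGraph_adj_iff.2 ⟨s⁻¹, .inr (Set.inv_mem_inv.2 hs), g, rfl, rfl⟩)
  intro v w
  obtain ⟨g, rfl⟩ := QuotientGroup.mk_surjective v
  obtain ⟨f, rfl⟩ := QuotientGroup.mk_surjective w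
  exact (symm (hone g)).trans (hone f)

theorem stabilizer_leftCoset_eq_smul (Q : Subgroup G) (s : G) :
    MulAction.stabilizer G (s : G ⧸ Q) = ConjAct.toConjAct s • Q :=
  calc MulAction.stabilizer G (s : G ⧸ Q)
    _ = MulAction.stabilizer G (s • ((1 : G) : G ⧸ Q)) :=
      congrArg (fun g : G => MulAction.stabilizer G (g : G ⧸ Q)) (mul_one s).symm
    _ = (MulAction.stabilizer G ((1 : G) : G ⧸ Q)).map (MulAut.conj s).toMonoidHom :=
      MulAction.stabilizer_smul_eq_stabilizer_map_conj s _
    _ = ConjAct.toConjAct s • Q := by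
      rw [MulAction.stabilizer_quotient]
      rfl

theorem finite_orbit_of_isQuasiNormal (hQ : Q.IsQuasiNormal) (s : G) :
    (MulAction.orbit Q (s : G ⧸ Q)).Finite := by
  have hs : s ∈ Subgroup.Commensurable.commensurator Q := hQ ▸ Subgroup.mem_top s
  have hstab : MulAction.stabilizer Q (s : G ⧸ Q) = (ConjAct.toConjAct s • Q).subgroupOf Q := by
    rw [← stabilizer_leftCoset_eq_smul]
    rfl
  refine Set.finite_of_ncard_ne_zero ?_
  rw [← MulAction.index_stabilizer, hstab]
  exact hs.1

theorem isLocallyFinite_cosetGraph (hQ : Q.IsQuasiNormal) (hS : S.Finite) :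
    GraphEnds.IsLocallyFinite (cosetGraph S Q) := fun v => by
  obtain ⟨g, rfl⟩ := QuotientGroup.mk_surjective v
  have hfin : (⋃ s ∈ S ∪ S⁻¹, g • MulAction.orbit Q (s : G ⧸ Q)).Finite :=
    (hS.union hS.inv).biUnion fun s _ => (finite_orbit_of_isQuasiNormal hQ s).smul_set
  refine hfin.subset fun w hw => ?_
  obtain ⟨s, hs, f, hfg, rfl⟩ := cosetGraph_adj_iff.1 hw
  obtain ⟨q, rfl⟩ : ∃ q : Q, f = g * q := ⟨⟨g⁻¹ * f, QuotientGroup.eq.1 hfg.symm⟩, by simp⟩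
  exact Set.mem_biUnion hs ⟨q • (s : G ⧸ Q), ⟨q, rfl⟩, (mul_smul g (q : G) (s : G ⧸ Q)).symm⟩

end CosetGraph

theorem theorem22 {G : Type*} [Group G] (Q : Subgroup G) (hQ : Q.IsQuasiNormal)
    (S : Set G) (hSfin : S.Finite) (hSgen : Subgroup.closure S = ⊤) :
    ((cosetGraph S Q).numEnds = 0 ∨ (cosetGraph S Q).numEnds = 1 ∨
      (cosetGraph S Q).numEnds = 2 ∨ Cardinal.aleph0 < (cosetGraph S Q).numEnds) ∧
    ∀ T : Set G, T.Finite → Subgroup.closure T = ⊤ →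
      (cosetGraph T Q).numEnds = (cosetGraph S Q).numEnds := by
  have hS_inv := isInvariant_cosetGraph S Q
  have hS_lf := isLocallyFinite_cosetGraph hQ hSfin
  have hS_conn := isConnected_cosetGraph (Q := Q) hSgen
  refine ⟨GraphEnds.numEnds_eq_zero_or_one_or_two_or_aleph0_lt hS_inv hS_lf hS_conn,
    fun T hTfin hTgen => ?_⟩
  exact GraphEnds.numEnds_eq_of_isInvariant (isInvariant_cosetGraph T Q)
    (isLocallyFinite_cosetGraph hQ hTfin) (isConnected_cosetGraph hTgen) hS_inv hS_lf hS_conn
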